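/- **Theorem (Expected number of events in a set).** Let $S$ be a Polish space with a compatible metric $d$ (for instance $\mathbb R^d$ or $\mathbb R^d_+$ with the distance of an $\ell_p$-norm). A *counting measure* on $S$ is a finite or countably infinite sum of unit point masses; the space of counting measures carries the $\sigma$-algebra generated by the maps $N\mapsto N(B)$, $B\subseteq S$ Borel. For counting measures with the same finite number $n$ of points, $N=\sum_{i=1}^n\delta_{x_i}$ and $N'=\sum_{i=1}^n\delta_{y_i}$, put $$\widetilde c(N,N')=\inf_{\sigma}\sum_{i=1}^{n} d(x_i,y_{\sigma(i)}),$$ the infimum being over permutations $\sigma$, and put $\widetilde c(N,N')=\infty$ if $N(S)\neq N'(S)$ or $N(S)\vee N'(S)=\infty$. Let $\widetilde c_\infty$ be the same cost without the last convention: it equals $\inf_\sigma\sum_{i} d(x_i,y_{\sigma(i)})$ whenever $N=\sum_i\delta_{x_i}$ and $N'=\sum_i\delta_{y_i}$ have equally many, possibly infinitely many, points, and $\infty$ otherwise. For laws $P,P_0$ of point processes let $W_c(P,P_0)$ be the infimum, over all couplings $\gamma$ of $P$ and $P_0$, of $\mathbb E_{(N,N')\sim\gamma}\,\widetilde c(N,N')$,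 and let $W_{c,\infty}$ be the same with $\widetilde c_\infty$. Let $P_0$ be the law of a Poisson point process $N=\sum_n\delta_{X^{(n)}}$ on $S$ with $\sigma$-finite intensity measure $\mu$, let $A\subseteq S$ be a nonempty Borel set, let $\delta\ge 0$, and write $\operatorname{dist}(x,A)=\inf_{y\in A}d(x,y)$. All suprema, infima and expectations below take values in $[0,\infty]$, and $P$ ranges over the laws of point processes on $S$ (random counting measures). 1. Suppose $\mu(S)<\infty$, so that $N$ has almost surely finitely many points. If $\delta>0$, then $$\sup_{W_c(P,P_0)\le\delta}\mathbb E_{N\sim P}[N(A)]=\min_{\lambda\ge 0}\Big[\lambda\delta+\mathbb E_{P_0}\sum_{n}\big(1-\lambda\operatorname{dist}(X^{(n)},A)\big)^+\Big],$$ the minimum being attained. If $\delta=0$ and $A$ is closed, the same identity holds with $\inf_{\lambda\ge0}$ in place of $\min_{\lambda\ge0}$. 2. For an arbitrary $\sigma$-finite $\mu$, so that $N$ may have infinitely many points, if $\delta>0$, then $$\sup_{W_{c,\infty}(P,P_0)\le\delta}\mathbb E_{N\sim P}[N(A)]=\min_{\lambda\ge 0}\Big[\lambda\delta+\mathbb E_{P_0}\sum_{n}\big(1-\lambda\operatorname{dist}(X^{(n)},A)\big)^+\Big],$$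 the minimum being attained. If $\delta=0$, $A$ is closed, and $\mathbb E_{P_0}\sum_n(1-\lambda\operatorname{dist}(X^{(n)},A))^+<\infty$ for some $\lambda\ge0$, the same identity holds with $\inf_{\lambda\ge0}$ in place of $\min_{\lambda\ge0}$. -/

import Mathlib

open MeasureTheory ProbabilityTheory
open scoped NNReal ENNReal

/-- A counting measure on `S`: a finite or countably infinite sum of unit point masses
(points may be repeated). -/
def IsCountingMeasure {S : Type*} [MeasurableSpace S] (N : Measure S) : Prop :=
  (∃ (n : ℕ) (x : Fin n → S), N = ∑ i, Measure.dirac (x i)) ∨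
    ∃ x : ℕ → S, N = Measure.sum fun i => Measure.dirac (x i)

/-- The space of counting measures on `S`, with the σ-algebra generated by the evaluations
`N ↦ N B`, for `B` measurable. A probability measure on it is the law of a point process. -/
abbrev PointConfig (S : Type*) [MeasurableSpace S] : Type _ :=
  {N : Measure S // IsCountingMeasure N}

/-- `P` is the law of a Poisson point process with intensity measure `μ`: the number of points
in a measurable set `B` has the Poisson distribution with mean `μ B` (it is almost surely
infinite if `μ B = ∞`), and the numbers of points in disjoint sets are independent. -/
structure IsPoissonProcess {S : Type*} [MeasurableSpace S] (μ : Measure S)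
    (P : Measure (PointConfig S)) : Prop where
  isProbabilityMeasure : IsProbabilityMeasure P
  map_count : ∀ B : Set S, MeasurableSet B → μ B ≠ ∞ →
    P.map (fun N => N.1 B) =
      (poissonMeasure (μ B).toNNReal).map (fun k : ℕ => (k : ℝ≥0∞))
  count_eq_top : ∀ B : Set S, MeasurableSet B → μ B = ∞ → ∀ᵐ N ∂P, N.1 B = ∞
  indep : ∀ (k : ℕ) (B : Fin k → Set S), (∀ i, MeasurableSet (B i)) →
    Pairwise (fun i j => Disjoint (B i) (B j)) →
    iIndepFun (fun (i : Fin k) (N : PointConfig S) => N.1 (B i)) P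

/-- The transport cost between two counting measures: if `N = ∑ i < n, δ_{x i}` and
`N' = ∑ i < n, δ_{y i}` have the same finite number `n` of points, it is
`κ n * inf_σ ∑ i, c (x i) (y (σ i))`, over the permutations `σ`; if the numbers of points differ
or are infinite, it is `∞` (an infimum over the empty set). The outer infimum runs over the
enumerations of the points, on which the inner one does not depend. -/
noncomputable def configCost {S : Type*} [MeasurableSpace S] (κ : ℕ → ℝ≥0) (c : S → S → ℝ≥0∞)
    (N N' : PointConfig S) : ℝ≥0∞ :=
  ⨅ (n : ℕ) (x : Fin n → S) (y : Fin n → S)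
    (_ : N.1 = ∑ i, Measure.dirac (x i)) (_ : N'.1 = ∑ i, Measure.dirac (y i)),
    (κ n : ℝ≥0∞) * ⨅ σ : Equiv.Perm (Fin n), ∑ i, c (x i) (y (σ i))

/-- The matching cost `inf_σ ∑ i, c (x i) (y (σ i))` between two counting measures
`N = ∑ i, δ_{x i}`, `N' = ∑ i, δ_{y i}` that both have infinitely many points,
and `∞` for all others. -/
noncomputable def infiniteConfigCost {S : Type*} [MeasurableSpace S] (c : S → S → ℝ≥0∞)
    (N N' : PointConfig S) : ℝ≥0∞ :=
  ⨅ (x : ℕ → S) (y : ℕ → S)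
    (_ : N.1 = Measure.sum fun i => Measure.dirac (x i))
    (_ : N'.1 = Measure.sum fun i => Measure.dirac (y i)),
    ⨅ σ : Equiv.Perm ℕ, ∑' i, c (x i) (y (σ i))

/-- The transport cost without the convention that it is `∞` between infinite counting
measures (and with scaling `κ = 1`): the matching cost between two counting measures with equally
many, possibly infinitely many, points, and `∞` if the numbers of points differ. -/
noncomputable def extConfigCost {S : Type*} [MeasurableSpace S] (c : S → S → ℝ≥0∞)
    (N N' : PointConfig S) : ℝ≥0∞ :=
  configCost (fun _ => 1) c N N' ⊓ infiniteConfigCost c N N'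

/-- The 1-Wasserstein (optimal transport) discrepancy with cost `C`: the infimum of
`E_γ [C]` over the couplings `γ` of `P` and `Q`. -/
noncomputable def wassersteinCost {X : Type*} [MeasurableSpace X] (C : X → X → ℝ≥0∞)
    (P Q : Measure X) : ℝ≥0∞ :=
  ⨅ (γ : Measure (X × X)) (_ : γ.map Prod.fst = P) (_ : γ.map Prod.snd = Q),
    ∫⁻ p, C p.1 p.2 ∂γ

/-- The worst-case expected number of points in `A`: the supremum of `E_P [N(A)]` over the laws
`P` of point processes with `W(P, P₀) ≤ δ`. -/
noncomputable def worstCaseCount {S : Type*} [MeasurableSpace S]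
    (C : PointConfig S → PointConfig S → ℝ≥0∞) (P₀ : Measure (PointConfig S)) (δ : ℝ≥0)
    (A : Set S) : ℝ≥0∞ :=
  ⨆ (P : Measure (PointConfig S)) (_ : IsProbabilityMeasure P)
    (_ : wassersteinCost C P P₀ ≤ δ), ∫⁻ N, N.1 A ∂P

/-- The expectation `E_{P₀} ∑ n, (1 - lam * dist (X⁽ⁿ⁾, A))⁺`, where `X⁽¹⁾, X⁽²⁾, …` are the points
of `N`; the sum is the integral with respect to the counting measure `N`. -/
noncomputable def expectedSoftCount {S : Type*} [MetricSpace S] [MeasurableSpace S]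
    (P₀ : Measure (PointConfig S)) (A : Set S) (lam : ℝ≥0) : ℝ≥0∞ :=
  ∫⁻ N, ∫⁻ x, ENNReal.ofReal (max (1 - lam * Metric.infDist x A) 0) ∂N.1 ∂P₀

/-- The dual objective `lam * δ + E_{P₀} ∑ n, (1 - lam * dist (X⁽ⁿ⁾, A))⁺`. -/
noncomputable def dualObjective {S : Type*} [MetricSpace S] [MeasurableSpace S]
    (P₀ : Measure (PointConfig S)) (δ : ℝ≥0) (A : Set S) (lam : ℝ≥0) : ℝ≥0∞ :=
  lam * δ + expectedSoftCount P₀ A lam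

/-- The expected number of points, for a Poisson number of points. -/
lemma lintegral_natCast_poissonMeasure (r : ℝ≥0) :
    ∫⁻ k : ℕ, (k : ℝ≥0∞) ∂poissonMeasure r = r := by
  have h : HasSum (fun n : ℕ => (n : ℝ) * (Real.exp (-r) * r ^ n / n.factorial)) r := by
    rw [hasSum_nat_add_iff' 1 |>.symm]
    have := (hasSum_one_poissonMeasure r).mul_left (r : ℝ)
    simp only [mul_one] at this
    convert! this using 1
    · ext n
      rw [Nat.factorial_succ]
      have : (n.factorial : ℝ) ≠ 0 := by positivity
      push_cast
      field_simp
      ring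
    · simp
  rw [poissonMeasure, lintegral_sum_measure]
  simp only [lintegral_smul_measure, lintegral_dirac, smul_eq_mul]
  have h2 : ∀ n : ℕ, ENNReal.ofReal (Real.exp (-r) * r ^ n / n.factorial) * (n : ℝ≥0∞) =
      ENNReal.ofReal ((n : ℝ) * (Real.exp (-r) * r ^ n / n.factorial)) := fun n => by
    rw [mul_comm, ENNReal.ofReal_mul (by positivity), ENNReal.ofReal_natCast]
  simp_rw [h2]
  rw [← ENNReal.ofReal_tsum_of_nonneg (fun n => by positivity) h.summable, h.tsum_eq,
    ENNReal.ofReal_coe_nnreal]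

/-! ### Mean measure of a Poisson process -/

namespace IsPoissonProcess

variable {S : Type*} [MeasurableSpace S] {μ : Measure S} {P₀ : Measure (PointConfig S)}

lemma lintegral_count (h : IsPoissonProcess μ P₀) {B : Set S} (hB : MeasurableSet B) :
    ∫⁻ N, N.1 B ∂P₀ = μ B := by
  have := h.isProbabilityMeasure
  have hm : Measurable fun N : PointConfig S => N.1 B :=
    (Measure.measurable_coe hB).comp measurable_subtype_coe
  by_cases hμ : μ B = ∞
  · rw [lintegral_congr_ae (h.count_eq_top B hB hμ)]
    simp [hμ]
  · have h1 : ∫⁻ N, N.1 B ∂P₀ = ∫⁻ k, k ∂(P₀.map fun N => N.1 B) :=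
      (lintegral_map measurable_id hm).symm
    rw [h1, h.map_count B hB hμ, lintegral_map (by fun_prop) (by fun_prop),
      lintegral_natCast_poissonMeasure, ENNReal.coe_toNNReal hμ]

/-- Campbell's formula. -/
lemma lintegral_lintegral (h : IsPoissonProcess μ P₀) {f : S → ℝ≥0∞} (hf : Measurable f) :
    ∫⁻ N, ∫⁻ x, f x ∂N.1 ∂P₀ = ∫⁻ x, f x ∂μ := by
  have hm : Measurable fun N : PointConfig S => N.1 := measurable_subtype_coe
  have hb : P₀.bind (fun N => N.1) = μ := by
    ext B hB
    rw [Measure.bind_apply hB hm.aemeasurable, h.lintegral_count hB]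
  rw [← Measure.lintegral_bind hm.aemeasurable hf.aemeasurable, hb]

lemma ae_count_ne_top (h : IsPoissonProcess μ P₀) [IsFiniteMeasure μ] :
    ∀ᵐ N ∂P₀, N.1 Set.univ ≠ ∞ := by
  have hm : Measurable fun N : PointConfig S => N.1 Set.univ :=
    (Measure.measurable_coe .univ).comp measurable_subtype_coe
  refine (ae_lt_top hm ?_).mono fun N hN => hN.ne
  rw [h.lintegral_count .univ]
  exact measure_ne_top μ _

end IsPoissonProcess

/-- A level between two values is a convex combination of them. -/
lemma ENNReal.exists_convexCombination {x y d : ℝ≥0∞} (hx : x ≤ d) (hy : d ≤ y) (hy' : y ≠ ∞) :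
    ∃ a b : ℝ≥0, a + b = 1 ∧ a * x + b * y = d := by
  lift y to ℝ≥0 using hy'
  lift d to ℝ≥0 using ne_top_of_le_ne_top ENNReal.coe_ne_top hy
  lift x to ℝ≥0 using ne_top_of_le_ne_top ENNReal.coe_ne_top hx
  have hx : (x : ℝ) ≤ d := by exact_mod_cast hx
  have hy : (d : ℝ) ≤ y := by exact_mod_cast hy
  have h : (d : ℝ) ∈ segment ℝ (x : ℝ) y := by
    rw [segment_eq_Icc (hx.trans hy)]
    exact ⟨hx, hy⟩
  obtain ⟨a, b, ha, hb, hab, h⟩ := h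
  simp only [smul_eq_mul] at h
  lift a to ℝ≥0 using ha
  lift b to ℝ≥0 using hb
  exact ⟨a, b, by exact_mod_cast hab, by exact_mod_cast h⟩

/-! ### The linear program: threshold sets and the critical level -/

section StrongDuality

open Filter Topology

variable {S : Type*} [MeasurableSpace S] {μ : Measure S} {φ : S → ℝ≥0∞}

/-- Integrates 1 = (1 - φ/s) + φ/s over `E`; the bound φ ≤ s makes the truncated subtraction exact.
It converts budget spent on `E` into value at price 1/s. -/
lemma measure_eq_add_withDensity (hφ : Measurable φ) {E : Set S} (hE : MeasurableSet E)
    {s : ℝ≥0∞} (h0 : s ≠ 0) (ht : s ≠ ∞) (hEs : ∀ x ∈ E, φ x ≤ s) :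
    μ E = ∫⁻ x in E, (1 - s⁻¹ * φ x) ∂μ + s⁻¹ * μ.withDensity φ E := by
  rw [withDensity_apply _ hE, ← lintegral_const_mul _ hφ, ← lintegral_add_right _ (by fun_prop),
    ← setLIntegral_one]
  refine setLIntegral_congr_fun hE fun x hx => ?_
  rw [tsub_add_cancel_of_le]
  calc s⁻¹ * φ x ≤ s⁻¹ * s := by gcongr; exact hEs x hx
    _ = 1 := ENNReal.inv_mul_cancel h0 ht

/-- Strong duality for the linear program of maximizing `∫ p dμ` over `0 ≤ p ≤ 1` with
`∫ p φ dμ ≤ δ`: it is enough to consider mixtures of two indicators. -/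
lemma exists_dual_le [SigmaFinite μ] (hφ : Measurable φ) (hφt : ∀ x, φ x ≠ ∞) {δ : ℝ≥0}
    (hδ : 0 < δ) {V : ℝ≥0∞}
    (hV : ∀ E F : Set S, MeasurableSet E → MeasurableSet F → ∀ a b : ℝ≥0, a + b = 1 →
      a * μ.withDensity φ E + b * μ.withDensity φ F ≤ δ → a * μ E + b * μ F ≤ V) :
    ∃ lam : ℝ≥0, lam * δ + ∫⁻ x, (1 - lam * φ x) ∂μ ≤ V := by
  have : SigmaFinite (μ.withDensity φ) :=
    SigmaFinite.withDensity_of_ne_top (ae_of_all _ hφt)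
  set ν := μ.withDensity φ with hν
  -- The levels whose sublevel sets are affordable. Their supremum is the critical level, itself
  -- affordable by continuity from below.
  let R : Set ℝ≥0∞ := {r | ν {x | φ x < r} ≤ δ}
  have hmeas : ∀ r, MeasurableSet {x | φ x < r} := fun r => measurableSet_lt hφ measurable_const
  have hR0 : (0 : ℝ≥0∞) ∈ R := by simp [R]
  set r := sSup R with hr
  have hrR : ν {x | φ x < r} ≤ δ := by
    obtain ⟨u, hu, -, hut, huR⟩ := (isLUB_sSup R).exists_seq_monotone_tendsto ⟨0, hR0⟩
    have : {x | φ x < r} ⊆ ⋃ n, {x | φ x < u n} := fun x hx => by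
      obtain ⟨n, hn⟩ := (hut.eventually_const_lt hx).exists
      exact Set.mem_iUnion.2 ⟨n, hn⟩
    refine (measure_mono this).trans ?_
    have hmono : Monotone fun n => {x | φ x < u n} := fun m n hmn x hx =>
      lt_of_lt_of_le (show φ x < u m from hx) (hu hmn)
    rw [hmono.measure_iUnion]
    exact iSup_le huR
  have hlt : ∀ s, r < s → δ < ν {x | φ x < s} := fun s hs =>
    not_le.1 fun h => (not_le.2 hs) (le_sSup (show s ∈ R from h))
  -- If every level is affordable, so is the whole space, and the budget has price 0.
  rcases eq_or_ne r ∞ with hrt | hrt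
  · refine ⟨0, ?_⟩
    have hu : {x | φ x < r} = Set.univ := by
      ext x; simp [hrt, (hφt x).lt_top]
    rw [hu] at hrR
    simpa using hV .univ .univ .univ .univ 1 0 (by simp) (by simpa using hrR)
  have key : r⁻¹ * δ + ∫⁻ x in {x | φ x < r}, (1 - r⁻¹ * φ x) ∂μ ≤ V := by
    have hs : ∀ s, r < s → s ≠ ∞ →
        s⁻¹ * δ + ∫⁻ x in {x | φ x < r}, (1 - r⁻¹ * φ x) ∂μ ≤ V := by
      intro s hs hst
      have hs0 : s ≠ 0 := (zero_le.trans_lt hs).ne'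
      -- `{φ < s}` may have infinite cost; σ-finiteness provides a subset of finite cost still
      -- exceeding δ, so that mixing it with `E` can spend exactly δ.
      obtain ⟨t, htm, hts, htδ, htt⟩ := Measure.exists_subset_measure_lt_top (hmeas s) (hlt s hs)
      set E := {x | φ x < r}
      have hEF : ν (E ∪ t) ≠ ∞ := by
        refine ((measure_union_le _ _).trans_lt (ENNReal.add_lt_top.2 ⟨?_, htt⟩)).ne
        exact hrR.trans_lt ENNReal.coe_lt_top
      obtain ⟨a, b, hab, hc⟩ := ENNReal.exists_convexCombination hrR
        (htδ.le.trans (measure_mono (Set.subset_union_right (s := E)))) hEF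
      refine le_trans ?_ (hV E (E ∪ t) (hmeas r) ((hmeas r).union htm) a b hab hc.le)
      rw [measure_eq_add_withDensity (E := E) hφ (hmeas r) hs0 hst fun x hx => (hx.trans hs).le,
        measure_eq_add_withDensity (E := E ∪ t) hφ ((hmeas r).union htm) hs0 hst
          (fun x hx => hx.elim (fun hx => (hx.trans hs).le) fun hx => (hts hx).le),
        ← hν, ← hc]
      have hab' : (a : ℝ≥0∞) + b = 1 := by exact_mod_cast hab
      have h1 : ∫⁻ x in E, (1 - r⁻¹ * φ x) ∂μ ≤ ∫⁻ x in E, (1 - s⁻¹ * φ x) ∂μ := by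
        gcongr
      have h2 : ∫⁻ x in E, (1 - r⁻¹ * φ x) ∂μ ≤ ∫⁻ x in E ∪ t, (1 - s⁻¹ * φ x) ∂μ :=
        h1.trans (lintegral_mono_set Set.subset_union_left)
      calc s⁻¹ * (a * ν E + b * ν (E ∪ t)) + ∫⁻ x in E, (1 - r⁻¹ * φ x) ∂μ
          = s⁻¹ * (a * ν E + b * ν (E ∪ t)) + (a * ∫⁻ x in E, (1 - r⁻¹ * φ x) ∂μ +
              b * ∫⁻ x in E, (1 - r⁻¹ * φ x) ∂μ) := by rw [← add_mul, hab', one_mul]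
        _ ≤ s⁻¹ * (a * ν E + b * ν (E ∪ t)) + (a * ∫⁻ x in E, (1 - s⁻¹ * φ x) ∂μ +
              b * ∫⁻ x in E ∪ t, (1 - s⁻¹ * φ x) ∂μ) := by gcongr
        _ = _ := by ring
    have hrt' : (𝓝[>] r).NeBot := nhdsGT_neBot_of_exists_gt ⟨∞, hrt.lt_top⟩
    have hlim : Tendsto (fun s => s⁻¹ * (δ : ℝ≥0∞) + ∫⁻ x in {x | φ x < r}, (1 - r⁻¹ * φ x) ∂μ)
        (𝓝[>] r) (𝓝 (r⁻¹ * δ + ∫⁻ x in {x | φ x < r}, (1 - r⁻¹ * φ x) ∂μ)) := by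
      refine Tendsto.add_const _ ?_
      refine ENNReal.Tendsto.mul_const ?_ (Or.inr ENNReal.coe_ne_top)
      exact (tendsto_inv_iff.2 tendsto_id).mono_left nhdsWithin_le_nhds
    refine le_of_tendsto hlim ?_
    filter_upwards [Ioo_mem_nhdsGT hrt.lt_top] with s hs' using hs s hs'.1 hs'.2.ne
  -- At r = 0 the term r⁻¹δ is infinite, hence so is `V`, and any multiplier works.
  rcases eq_or_ne r 0 with hr0 | hr0
  · refine ⟨0, le_of_le_of_eq le_top (top_le_iff.1 (le_trans ?_ key)).symm⟩
    simp [hr0, ENNReal.top_mul, hδ.ne']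
  · refine ⟨r.toNNReal⁻¹, le_trans (le_of_eq ?_) key⟩
    have hr' : ((r.toNNReal⁻¹ : ℝ≥0) : ℝ≥0∞) = r⁻¹ := by
      rw [ENNReal.coe_inv (ENNReal.toNNReal_ne_zero.2 ⟨hr0, hrt⟩), ENNReal.coe_toNNReal hrt]
    rw [hr', setLIntegral_eq_of_support_subset]
    intro x hx
    by_contra hxr
    refine hx (tsub_eq_zero_of_le ?_)
    calc 1 = r⁻¹ * r := (ENNReal.inv_mul_cancel hr0 hrt).symm
      _ ≤ r⁻¹ * φ x := by gcongr; exact not_lt.1 hxr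

end StrongDuality

/-- Measurable near-selection of a closest point in a set. -/
lemma exists_measurable_edist_le_infEDist_add {S : Type*} [MetricSpace S]
    [SecondCountableTopology S] [MeasurableSpace S] [BorelSpace S] {A : Set S}
    (hne : A.Nonempty) {η : S → ℝ≥0} (hη : Measurable η) (hη0 : ∀ x, 0 < η x) :
    ∃ T : S → S, Measurable T ∧ (∀ x, T x ∈ A) ∧
      ∀ x, edist (T x) x ≤ Metric.infEDist x A + η x := by
  have := hne.to_subtype
  let u : ℕ → A := TopologicalSpace.denseSeq A
  have hex : ∀ x, ∃ n, edist (u n : S) x < Metric.infEDist x A + η x := fun x => by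
    have hlt : Metric.infEDist x A < Metric.infEDist x A + η x :=
      ENNReal.lt_add_right (Metric.infEDist_ne_top hne) (by simpa using (hη0 x).ne')
    obtain ⟨y, hy, hxy⟩ := Metric.infEDist_lt_iff.1 hlt
    have ho : IsOpen {z : A | edist (z : S) x < Metric.infEDist x A + η x} :=
      isOpen_lt (by fun_prop) continuous_const
    exact (TopologicalSpace.denseRange_denseSeq A).exists_mem_open ho
      ⟨⟨y, hy⟩, by simpa [edist_comm] using hxy⟩
  -- Taking the least admissible index in the dense sequence makes the choice measurable.
  classical
  refine ⟨fun x => u (Nat.find (hex x)), ?_, fun x => (u _).2, fun x => (Nat.find_spec (hex x)).le⟩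
  have hm : Measurable fun x => Nat.find (hex x) := by
    refine measurable_find hex fun k => measurableSet_lt (by fun_prop) ?_
    exact measurable_infEDist.add hη.coe_nnreal_ennreal
  exact (measurable_from_nat (f := fun n => (u n : S))).comp hm

/-! ### Displaced configurations and bounds on matching costs -/

section Map

variable {S : Type*} [MeasurableSpace S]

lemma IsCountingMeasure.map {N : Measure S} (hN : IsCountingMeasure N) {T : S → S}
    (hT : Measurable T) : IsCountingMeasure (N.map T) := by
  rcases hN with ⟨n, x, rfl⟩ | ⟨x, rfl⟩
  · refine Or.inl ⟨n, fun i => T (x i), ?_⟩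
    rw [Measure.map_finset_sum hT.aemeasurable]
    simp_rw [Measure.map_dirac' hT]
  · refine Or.inr ⟨fun i => T (x i), ?_⟩
    rw [Measure.map_sum hT.aemeasurable]
    simp_rw [Measure.map_dirac' hT]

/-- Move all the points of a configuration by a measurable map. -/
noncomputable def PointConfig.map {T : S → S} (hT : Measurable T) (N : PointConfig S) :
    PointConfig S :=
  ⟨N.1.map T, N.2.map hT⟩

lemma PointConfig.measurable_map {T : S → S} (hT : Measurable T) :
    Measurable (PointConfig.map hT) :=
  ((Measure.measurable_map T hT).comp measurable_subtype_coe).subtype_mk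

lemma PointConfig.measurable_count {A : Set S} (hA : MeasurableSet A) :
    Measurable fun N : PointConfig S => N.1 A :=
  (Measure.measurable_coe hA).comp measurable_subtype_coe

/-- The identity permutation matches each displaced point with its origin. Finiteness is needed
since this cost is infinite between infinite configurations. -/
lemma configCost_map_le {c : S → S → ℝ≥0∞} (hc : Measurable (Function.uncurry c)) {T : S → S}
    (hT : Measurable T) {N : PointConfig S} (hN : N.1 Set.univ ≠ ∞) :
    configCost (fun _ => 1) c (N.map hT) N ≤ ∫⁻ x, c (T x) x ∂N.1 := by
  have hm : Measurable fun x => c (T x) x := hc.comp (hT.prodMk measurable_id)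
  rcases N.2 with ⟨n, x, hx⟩ | ⟨x, hx⟩
  · have hTx : (N.map hT).1 = ∑ i, Measure.dirac (T (x i)) := by
      rw [show (N.map hT).1 = N.1.map T from rfl, hx, Measure.map_finset_sum hT.aemeasurable]
      simp_rw [Measure.map_dirac' hT]
    refine iInf_le_of_le n <| iInf_le_of_le (fun i => T (x i)) <| iInf_le_of_le x <|
      iInf_le_of_le hTx <| iInf_le_of_le hx ?_
    rw [hx, lintegral_finsetSum_measure, ENNReal.coe_one, one_mul]
    refine iInf_le_of_le 1 (le_of_eq (Finset.sum_congr rfl fun i _ => ?_))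
    rw [lintegral_dirac' _ hm]
    rfl
  · refine absurd ?_ hN
    simp [hx]

lemma extConfigCost_map_le {c : S → S → ℝ≥0∞} (hc : Measurable (Function.uncurry c)) {T : S → S}
    (hT : Measurable T) (N : PointConfig S) :
    extConfigCost c (N.map hT) N ≤ ∫⁻ x, c (T x) x ∂N.1 := by
  have hm : Measurable fun x => c (T x) x := hc.comp (hT.prodMk measurable_id)
  by_cases hN : N.1 Set.univ = ∞
  · refine inf_le_right.trans ?_
    rcases N.2 with ⟨n, x, hx⟩ | ⟨x, hx⟩
    · simp [hx] at hN
    have hTx : (N.map hT).1 = Measure.sum fun i => Measure.dirac (T (x i)) := by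
      rw [show (N.map hT).1 = N.1.map T from rfl, hx, Measure.map_sum hT.aemeasurable]
      simp_rw [Measure.map_dirac' hT]
    refine iInf_le_of_le (fun i => T (x i)) <| iInf_le_of_le x <|
      iInf_le_of_le hTx <| iInf_le_of_le hx ?_
    rw [hx, lintegral_sum_measure]
    refine iInf_le_of_le 1 (le_of_eq (tsum_congr fun i => ?_))
    rw [lintegral_dirac' _ hm]
    rfl
  · exact inf_le_left.trans (configCost_map_le hc hT hN)

/-- A pointwise dual constraint bounds the finite matching cost from below. -/
lemma count_tsub_div_le_configCost {c : S → S → ℝ≥0∞} {A : Set S} (hA : MeasurableSet A)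
    {lam : ℝ≥0∞} {g : S → ℝ≥0∞} (hg : Measurable g)
    (h : ∀ x y, A.indicator 1 x ≤ lam * c x y + g y) (N N' : PointConfig S) :
    (N.1 A - ∫⁻ y, g y ∂N'.1) / lam ≤ configCost (fun _ => 1) c N N' := by
  refine le_iInf fun n => le_iInf fun x => le_iInf fun y => le_iInf fun hx => le_iInf fun hy => ?_
  rw [ENNReal.coe_one, one_mul]
  refine le_iInf fun σ => ENNReal.div_le_of_le_mul (tsub_le_iff_right.2 ?_)
  rw [hx, hy, lintegral_finsetSum_measure]
  simp only [Measure.finsetSum_apply, Measure.dirac_apply' _ hA, lintegral_dirac' _ hg]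
  rw [← Equiv.sum_comp σ fun i => g (y i), Finset.sum_mul, ← Finset.sum_add_distrib]
  exact Finset.sum_le_sum fun i _ => (h _ _).trans_eq (by rw [mul_comm])

lemma count_tsub_div_le_infiniteConfigCost {c : S → S → ℝ≥0∞} {A : Set S} (hA : MeasurableSet A)
    {lam : ℝ≥0∞} {g : S → ℝ≥0∞} (hg : Measurable g)
    (h : ∀ x y, A.indicator 1 x ≤ lam * c x y + g y) (N N' : PointConfig S) :
    (N.1 A - ∫⁻ y, g y ∂N'.1) / lam ≤ infiniteConfigCost c N N' := by
  refine le_iInf fun x => le_iInf fun y => le_iInf fun hx => le_iInf fun hy => ?_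
  refine le_iInf fun σ => ENNReal.div_le_of_le_mul (tsub_le_iff_right.2 ?_)
  rw [hx, hy, lintegral_sum_measure, Measure.sum_apply _ hA]
  simp only [Measure.dirac_apply' _ hA, lintegral_dirac' _ hg]
  rw [← Equiv.tsum_eq σ fun i => g (y i), ← ENNReal.tsum_mul_right, ← ENNReal.tsum_add]
  exact ENNReal.tsum_le_tsum fun i => (h _ _).trans_eq (by rw [mul_comm])

lemma count_tsub_div_le_extConfigCost {c : S → S → ℝ≥0∞} {A : Set S} (hA : MeasurableSet A)
    {lam : ℝ≥0∞} {g : S → ℝ≥0∞} (hg : Measurable g)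
    (h : ∀ x y, A.indicator 1 x ≤ lam * c x y + g y) (N N' : PointConfig S) :
    (N.1 A - ∫⁻ y, g y ∂N'.1) / lam ≤ extConfigCost c N N' :=
  le_inf (count_tsub_div_le_configCost hA hg h N N')
    (count_tsub_div_le_infiniteConfigCost hA hg h N N')

/-- Mixtures of displaced Poisson processes are competitors in the worst-case problem. -/
lemma sum_mul_measure_preimage_le_worstCaseCount {μ : Measure S} {P₀ : Measure (PointConfig S)}
    (hP₀ : IsPoissonProcess μ P₀) {C : PointConfig S → PointConfig S → ℝ≥0∞}
    {c : S → S → ℝ≥0∞} (hc : Measurable (Function.uncurry c))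
    (hC : ∀ (T : S → S) (hT : Measurable T), ∀ᵐ N ∂P₀, C (N.map hT) N ≤ ∫⁻ x, c (T x) x ∂N.1)
    {A : Set S} (hA : MeasurableSet A) {δ : ℝ≥0} {ι : Type*} [Fintype ι] (w : ι → ℝ≥0)
    (hw : ∑ i, w i = 1) (T : ι → S → S) (hT : ∀ i, Measurable (T i))
    (hδ : ∑ i, w i * ∫⁻ x, c (T i x) x ∂μ ≤ δ) :
    ∑ i, w i * μ (T i ⁻¹' A) ≤ worstCaseCount C P₀ δ A := by
  have := hP₀.isProbabilityMeasure
  have hM := fun i => PointConfig.measurable_map (hT i)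
  have hpair : ∀ i, Measurable fun N : PointConfig S => (N.map (hT i), N) := fun i =>
    (hM i).prodMk measurable_id
  have hw' : ∑ i, (w i : ℝ≥0∞) = 1 := by exact_mod_cast hw
  let P : Measure (PointConfig S) := ∑ i, w i • P₀.map (PointConfig.map (hT i))
  -- Draw `i` with probability `w i`, independently of `N`, and couple `N` with its image under `T
  -- i`.
  let γ : Measure (PointConfig S × PointConfig S) :=
    ∑ i, w i • P₀.map fun N => (N.map (hT i), N)
  have hP : IsProbabilityMeasure P := by
    constructor
    simp only [P, Measure.finsetSum_apply, Measure.smul_apply, Measure.map_apply (hM _) .univ,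
      Set.preimage_univ, measure_univ]
    simpa [ENNReal.smul_def] using hw'
  have hfst : γ.map Prod.fst = P := by
    rw [Measure.map_finset_sum measurable_fst.aemeasurable]
    refine Finset.sum_congr rfl fun i _ => ?_
    rw [Measure.map_smul, Measure.map_map measurable_fst (hpair i)]
    rfl
  have hsnd : γ.map Prod.snd = P₀ := by
    rw [Measure.map_finset_sum measurable_snd.aemeasurable]
    have h1 : ∀ i, (P₀.map fun N => (N.map (hT i), N)).map Prod.snd = P₀ := fun i => by
      rw [Measure.map_map measurable_snd (hpair i)]
      exact Measure.map_id
    simp_rw [Measure.map_smul, h1]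
    rw [← Finset.sum_smul, hw, one_smul]
  have hcost : wassersteinCost C P P₀ ≤ δ := by
    refine iInf_le_of_le γ <| iInf_le_of_le hfst <| iInf_le_of_le hsnd <| le_trans ?_ hδ
    rw [lintegral_finsetSum_measure]
    gcongr with i
    rw [lintegral_smul_measure, ENNReal.smul_def, smul_eq_mul]
    gcongr
    refine (lintegral_map_le _ _).trans ((lintegral_mono_ae (hC _ (hT i))).trans_eq ?_)
    exact hP₀.lintegral_lintegral (hc.comp ((hT i).prodMk measurable_id))
  refine le_trans (le_of_eq ?_) (le_iSup_of_le P <| le_iSup_of_le hP <| le_iSup_of_le hcost le_rfl)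
  rw [lintegral_finsetSum_measure]
  refine Finset.sum_congr rfl fun i _ => ?_
  rw [lintegral_smul_measure, ENNReal.smul_def, smul_eq_mul,
    lintegral_map (PointConfig.measurable_count hA) (hM i), ← hP₀.lintegral_count (hT i hA)]
  simp only [PointConfig.map, Measure.map_apply (hT i) hA]

end Map

/-! ### Weak and strong duality for the worst-case count -/

section Duality

variable {S : Type*} [MetricSpace S] {A : Set S}

lemma ofReal_max_one_sub_mul_infDist (hne : A.Nonempty) (lam : ℝ≥0) (x : S) :
    ENNReal.ofReal (max (1 - lam * Metric.infDist x A) 0) = 1 - lam * Metric.infEDist x A := by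
  rw [ENNReal.ofReal_max, ENNReal.ofReal_zero, max_eq_left zero_le,
    ENNReal.ofReal_sub _ (mul_nonneg lam.coe_nonneg Metric.infDist_nonneg), ENNReal.ofReal_one,
    ENNReal.ofReal_mul lam.coe_nonneg, ENNReal.ofReal_coe_nnreal, Metric.infDist,
    ENNReal.ofReal_toReal (Metric.infEDist_ne_top hne)]

/-- For x in `A` the distance from y to `A` is at most d(x, y). This is the dual feasibility of the
soft count. -/
lemma indicator_one_le_mul_edist_add (lam : ℝ≥0) (x y : S) :
    A.indicator 1 x ≤ lam * edist x y + (1 - lam * Metric.infEDist y A) := by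
  by_cases hx : x ∈ A
  · rw [Set.indicator_of_mem hx, Pi.one_apply, edist_comm]
    refine (le_add_tsub (b := lam * Metric.infEDist y A)).trans ?_
    gcongr
    exact Metric.infEDist_le_edist_of_mem hx
  · simp [hx]

variable [MeasurableSpace S] {P₀ : Measure (PointConfig S)}

lemma expectedSoftCount_eq (hne : A.Nonempty) (lam : ℝ≥0) :
    expectedSoftCount P₀ A lam = ∫⁻ N, ∫⁻ x, (1 - lam * Metric.infEDist x A) ∂N.1 ∂P₀ := by
  simp only [expectedSoftCount, ofReal_max_one_sub_mul_infDist hne]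

variable [BorelSpace S]

lemma measurable_softCount (lam : ℝ≥0) :
    Measurable fun x : S => 1 - (lam : ℝ≥0∞) * Metric.infEDist x A :=
  measurable_const.sub (measurable_infEDist.const_mul _)

/-- Weak duality. The cost `C` may fail to be measurable. -/
lemma worstCaseCount_le_dualObjective {C : PointConfig S → PointConfig S → ℝ≥0∞}
    (hA : MeasurableSet A) (hne : A.Nonempty)
    (hC : ∀ (lam : ℝ≥0∞) (g : S → ℝ≥0∞), Measurable g →
      (∀ x y, A.indicator 1 x ≤ lam * edist x y + g y) →
      ∀ N N', (N.1 A - ∫⁻ y, g y ∂N'.1) / lam ≤ C N N') (δ lam : ℝ≥0) :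
    worstCaseCount C P₀ δ A ≤ dualObjective P₀ δ A lam := by
  have hpos : ∀ lam : ℝ≥0, 0 < lam → worstCaseCount C P₀ δ A ≤ dualObjective P₀ δ A lam := by
    intro lam hlam
    have hl0 : (lam : ℝ≥0∞) ≠ 0 := by simpa using hlam.ne'
    refine iSup_le fun P => iSup_le fun _ => iSup_le fun hW => ?_
    rw [dualObjective, ← tsub_le_iff_right, mul_comm, ← ENNReal.div_le_iff hl0 ENNReal.coe_ne_top]
    refine le_trans ?_ hW
    refine le_iInf fun γ => le_iInf fun hfst => le_iInf fun hsnd => ?_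
    refine ENNReal.div_le_of_le_mul (tsub_le_iff_right.2 ?_)
    have hg := measurable_softCount (A := A) lam
    have hG : Measurable fun N : PointConfig S =>
        ∫⁻ x, (1 - lam * Metric.infEDist x A) ∂N.1 :=
      (Measure.measurable_lintegral hg).comp measurable_subtype_coe
    rw [expectedSoftCount_eq hne, ← hfst, ← hsnd,
      lintegral_map (PointConfig.measurable_count hA) measurable_fst,
      lintegral_map hG measurable_snd, mul_comm, ← lintegral_const_mul' _ _ ENNReal.coe_ne_top,
      ← lintegral_add_right _ (by exact hG.comp measurable_snd)]
    refine lintegral_mono fun p => ?_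
    have := hC lam _ hg (indicator_one_le_mul_edist_add lam) p.1 p.2
    rwa [ENNReal.div_le_iff hl0 ENNReal.coe_ne_top, tsub_le_iff_right, mul_comm] at this
  rcases eq_zero_or_pos lam with rfl | hlam
  -- Division by λ is unavailable at λ = 0. A small λ costs at most ε in λδ, while the soft count
  -- only decreases in λ.
  · refine ENNReal.le_of_forall_pos_le_add fun ε hε _ => ?_
    have hlam : 0 < ε / (δ + 1) := by positivity
    refine (hpos _ hlam).trans ?_
    rw [dualObjective, dualObjective, add_comm _ (ε : ℝ≥0∞), ENNReal.coe_zero, zero_mul, zero_add]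
    gcongr
    · rw [← ENNReal.coe_mul, ENNReal.coe_le_coe]
      calc ε / (δ + 1) * δ ≤ ε / (δ + 1) * (δ + 1) := by gcongr; simp
        _ = ε := div_mul_cancel₀ _ (by positivity)
    · rw [expectedSoftCount_eq hne, expectedSoftCount_eq hne]
      gcongr
  · exact hpos lam hlam

variable [SecondCountableTopology S]

/-- Strong duality for matching costs between Poisson processes and other point processes. -/
theorem worstCaseCount_duality {μ : Measure S} [SigmaFinite μ] (hP₀ : IsPoissonProcess μ P₀)
    {C : PointConfig S → PointConfig S → ℝ≥0∞} (hA : MeasurableSet A) (hne : A.Nonempty)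
    (hC : ∀ (lam : ℝ≥0∞) (g : S → ℝ≥0∞), Measurable g →
      (∀ x y, A.indicator 1 x ≤ lam * edist x y + g y) →
      ∀ N N', (N.1 A - ∫⁻ y, g y ∂N'.1) / lam ≤ C N N')
    (hC' : ∀ (T : S → S) (hT : Measurable T), ∀ᵐ N ∂P₀,
      C (N.map hT) N ≤ ∫⁻ x, edist (T x) x ∂N.1) (δ : ℝ≥0) :
    (0 < δ → IsLeast (Set.range (dualObjective P₀ δ A)) (worstCaseCount C P₀ δ A)) ∧
      (δ = 0 → IsClosed A → (∃ lam : ℝ≥0, expectedSoftCount P₀ A lam ≠ ∞) →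
        worstCaseCount C P₀ δ A = ⨅ lam : ℝ≥0, dualObjective P₀ δ A lam) := by
  have hweak := worstCaseCount_le_dualObjective (P₀ := P₀) hA hne hC δ
  have hsoft : ∀ lam : ℝ≥0, expectedSoftCount P₀ A lam =
      ∫⁻ x, (1 - lam * Metric.infEDist x A) ∂μ := fun lam => by
    rw [expectedSoftCount_eq hne, hP₀.lintegral_lintegral (measurable_softCount lam)]
  have hφ : Measurable fun x : S => Metric.infEDist x A := measurable_infEDist
  have hmix := fun {ι : Type} [Fintype ι] =>
    sum_mul_measure_preimage_le_worstCaseCount (ι := ι) (δ := δ) hP₀ measurable_edist hC' hA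
  constructor
  · intro hδ
    refine ⟨?_, by rintro _ ⟨lam, rfl⟩; exact hweak lam⟩
    suffices h : ∃ lam : ℝ≥0, dualObjective P₀ δ A lam ≤ worstCaseCount C P₀ δ A by
      obtain ⟨lam, h⟩ := h
      exact ⟨lam, h.antisymm (hweak lam)⟩
    simp only [dualObjective, hsoft]
    refine exists_dual_le hφ (fun x => Metric.infEDist_ne_top hne) hδ ?_
    intro E F hE hF a b hab hbud
    refine ENNReal.le_of_forall_lt_one_mul_le fun t ht => ?_
    lift t to ℝ≥0 using ht.ne_top
    replace ht : t < 1 := by exact_mod_cast ht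
    obtain ⟨s, hst⟩ : ∃ s, t + s = 1 := ⟨1 - t, add_tsub_cancel_of_le ht.le⟩
    have hs : 0 < s := by
      rcases eq_zero_or_pos s with rfl | h
      · simp [← hst] at ht
      · exact h
    -- The selection error costs at most sδ in total, and weight s = 1 - t stays on the identity:
    -- the mixture costs at most t(1 + s)δ = (1 - s²)δ ≤ δ.
    obtain ⟨η, hη0, hη, hηδ⟩ := exists_pos_lintegral_lt_of_sigmaFinite μ
      (ε := (s * δ : ℝ≥0)) (by simpa using ⟨hs.ne', hδ.ne'⟩)
    obtain ⟨T, hT, hTA, hTd⟩ := exists_measurable_edist_le_infEDist_add hne hη hη0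
    classical
    have hpw : ∀ E, MeasurableSet E → Measurable (E.piecewise T id) := fun E hE =>
      hT.piecewise hE measurable_id
    have hcost : ∀ E, MeasurableSet E → ∫⁻ x, edist (E.piecewise T id x) x ∂μ ≤
        μ.withDensity (fun x => Metric.infEDist x A) E + (s * δ : ℝ≥0) := by
      intro E hE
      calc ∫⁻ x, edist (E.piecewise T id x) x ∂μ
          ≤ ∫⁻ x, E.indicator (fun x => Metric.infEDist x A) x + η x ∂μ := by
            refine lintegral_mono fun x => ?_
            by_cases hx : x ∈ E
            · simpa [hx] using hTd x
            · simp [hx]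
        _ = μ.withDensity (fun x => Metric.infEDist x A) E + ∫⁻ x, η x ∂μ := by
            rw [lintegral_add_right _ hη.coe_nnreal_ennreal, lintegral_indicator hE,
              withDensity_apply _ hE]
        _ ≤ _ := by gcongr
    have hval : ∀ E, μ E ≤ μ (E.piecewise T id ⁻¹' A) := fun E =>
      measure_mono fun x hx => by simp [hx, hTA]
    have hab' : (a : ℝ≥0∞) + b = 1 := by exact_mod_cast hab
    have h := hmix ![t * a, t * b, s] (by simp [Fin.sum_univ_three, ← mul_add, hab, hst])
      ![E.piecewise T id, F.piecewise T id, id]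
      (fun i => by fin_cases i; exacts [hpw E hE, hpw F hF, measurable_id]) (by
        simp only [Fin.sum_univ_three, Matrix.cons_val, id, edist_self, lintegral_zero, mul_zero,
          add_zero]
        calc ((t * a : ℝ≥0) : ℝ≥0∞) * ∫⁻ x, edist (E.piecewise T id x) x ∂μ +
              ((t * b : ℝ≥0) : ℝ≥0∞) * ∫⁻ x, edist (F.piecewise T id x) x ∂μ
            ≤ (t * a : ℝ≥0) * (μ.withDensity (fun x => Metric.infEDist x A) E + (s * δ : ℝ≥0)) +
              (t * b : ℝ≥0) * (μ.withDensity (fun x => Metric.infEDist x A) F +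
                (s * δ : ℝ≥0)) := by
              gcongr
              exacts [hcost E hE, hcost F hF]
          _ = t * (a * μ.withDensity (fun x => Metric.infEDist x A) E +
                b * μ.withDensity (fun x => Metric.infEDist x A) F + (a + b) * (s * δ)) := by
              push_cast; ring
          _ ≤ t * (δ + 1 * (s * δ)) := by rw [hab']; gcongr
          _ ≤ δ := by
              norm_cast
              have : t * (1 + s) ≤ 1 := by
                rw [← NNReal.coe_le_coe]
                have : (t : ℝ) + s = 1 := by exact_mod_cast hst
                push_cast
                nlinarith [sq_nonneg (s : ℝ)]
              calc t * (δ + 1 * (s * δ)) = t * (1 + s) * δ := by ring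
                _ ≤ 1 * δ := by gcongr
                _ = δ := one_mul _)
    refine le_trans ?_ h
    simp only [Fin.sum_univ_three, Matrix.cons_val]
    refine le_trans ?_ le_self_add
    push_cast
    rw [mul_add, mul_assoc, mul_assoc]
    gcongr t * (a * ?_) + t * (b * ?_)
    exacts [hval E, hval F]
  · rintro rfl hcl ⟨lam₀, hfin⟩
    refine le_antisymm (le_iInf hweak) ?_
    have hμ : μ A ≤ worstCaseCount C P₀ 0 A := by
      simpa using hmix (ι := Unit) (fun _ => 1) (by simp) (fun _ => id) (fun _ => measurable_id)
        (by simp)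
    refine le_trans ?_ hμ
    -- Starting at `lam₀` makes the first integral finite, as monotone convergence for decreasing
    -- sequences requires.
    let f : ℕ → S → ℝ≥0∞ := fun n x => 1 - ((lam₀ + n : ℝ≥0) : ℝ≥0∞) * Metric.infEDist x A
    have hanti : Antitone f := fun m n hmn x => by
      simp only [f]
      gcongr
    have hlim : ∫⁻ x, ⨅ n, f n x ∂μ = ⨅ n, ∫⁻ x, f n x ∂μ :=
      lintegral_iInf (fun n => measurable_softCount _) hanti (by simpa [f, ← hsoft] using hfin)
    calc ⨅ lam : ℝ≥0, dualObjective P₀ 0 A lam ≤ ⨅ n, ∫⁻ x, f n x ∂μ := by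
          refine le_iInf fun n => iInf_le_of_le (lam₀ + n) ?_
          simp [dualObjective, hsoft, f]
      _ = ∫⁻ x, ⨅ n, f n x ∂μ := hlim.symm
      _ ≤ ∫⁻ x, A.indicator 1 x ∂μ := by
          refine lintegral_mono fun x => ?_
          by_cases hx : x ∈ A
          · rw [Set.indicator_of_mem hx]
            exact iInf_le_of_le 0 tsub_le_self
          · have h0 : Metric.infEDist x A ≠ 0 := fun h =>
              hx ((Metric.mem_iff_infEDist_zero_of_closed hcl).2 h)
            obtain ⟨n, hn⟩ := ENNReal.exists_nat_mul_gt h0 ENNReal.one_ne_top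
            refine iInf_le_of_le n (le_of_eq_of_le (tsub_eq_zero_of_le ?_) zero_le)
            refine hn.le.trans ?_
            push_cast
            gcongr
            exact le_add_self
      _ = μ A := lintegral_indicator_one hA

end Duality

theorem mainTheorem6 {S : Type*} [MetricSpace S] [PolishSpace S] [MeasurableSpace S]
    [BorelSpace S] (μ : Measure S) [SigmaFinite μ] (P₀ : Measure (PointConfig S))
    (hP₀ : IsPoissonProcess μ P₀) (A : Set S) (hA : MeasurableSet A) (hne : A.Nonempty)
    (δ : ℝ≥0) :
    (IsFiniteMeasure μ →
      (0 < δ → IsLeast (Set.range (dualObjective P₀ δ A))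
        (worstCaseCount (configCost (fun _ => 1) edist) P₀ δ A)) ∧
      (δ = 0 → IsClosed A →
        worstCaseCount (configCost (fun _ => 1) edist) P₀ δ A =
          ⨅ lam : ℝ≥0, dualObjective P₀ δ A lam)) ∧
    (0 < δ → IsLeast (Set.range (dualObjective P₀ δ A))
      (worstCaseCount (extConfigCost edist) P₀ δ A)) ∧
    (δ = 0 → IsClosed A → (∃ lam : ℝ≥0, expectedSoftCount P₀ A lam ≠ ∞) →
      worstCaseCount (extConfigCost edist) P₀ δ A =
        ⨅ lam : ℝ≥0, dualObjective P₀ δ A lam) := by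
  have hext := worstCaseCount_duality (C := extConfigCost edist) hP₀ hA hne
    (fun _ _ hg h => count_tsub_div_le_extConfigCost hA hg h)
    (fun _ hT => ae_of_all _ fun N => extConfigCost_map_le measurable_edist hT N) δ
  refine ⟨fun hμ => ?_, hext.1, hext.2⟩
  have hfin := worstCaseCount_duality (C := configCost (fun _ => 1) edist) hP₀ hA hne
    (fun _ _ hg h => count_tsub_div_le_configCost hA hg h)
    (fun _ hT => hP₀.ae_count_ne_top.mono fun N hN => configCost_map_le measurable_edist hT hN) δ
  -- At λ = 0 the expected soft count is μ(S), which is finite here.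
  refine ⟨hfin.1, fun hδ hcl => hfin.2 hδ hcl ⟨0, ?_⟩⟩
  rw [expectedSoftCount_eq hne, hP₀.lintegral_lintegral (measurable_softCount 0)]
  simp
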